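/- Let $n,m,q\ge 0$ and $N,K,I\ge 1$ be integers, $\|\cdot\|$ a norm on $\mathbb R^m$ with dual norm $\|z\|_*=\sup_{\|w\|\le 1}\langle z,w\rangle$, $\mathscr X\subseteq\mathbb R^n$, $f:\mathbb R^n\to\mathbb R\cup\{\pm\infty\}$, $C\in\mathbb R^{q\times m}$, $d\in\mathbb R^q$, and $\Xi=\{w\in\mathbb R^m: Cw\le d\}$. Let the loss be $g(x,w)=\max_{i\in[I]}\big(\langle a_i(x),w\rangle+b_i\big)$ with $a_i:\mathbb R^n\to\mathbb R^m$ and $b_i\in\mathbb R$. (No convexity of $\mathscr X$, $f$ or $a_i$ is required.) Let $\widehat w_1,\dots,\widehat w_N\in\Xi$ be data whose indices are partitioned into $K$ nonempty clusters $\Gamma_1,\dots,\Gamma_K$, write $N_k=|\Gamma_k|$, and let $k(l)$ be the cluster that contains $l$. Let $\theta_1,\dots,\theta_K\ge 0$, and let $\widehat{\mathbb P}_k=\frac1{N_k}\sum_{l\in\Gamma_k}\delta_{\widehat w_l}$. Let $\mathscr W_k$ be the set of Borel probability measures $\mathbb Q$ supported on $\Xi$ with $d_W(\mathbb Q,\widehat{\mathbb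 P}_k)\le\theta_k$, where $d_W(\mathbb Q,\mathbb P)=\inf_\pi\int\|u-v\|\,d\pi(u,v)$ over all measures $\pi$ with marginals $\mathbb Q$ and $\mathbb P$. Let $\mathscr B=\big\{\sum_{k=1}^K\frac{N_k}{N}\mathbb Q_k:\ \mathbb Q_k\in\mathscr W_k\big\}$. Consider the distributionally robust (BNWDRO) problem $$\text{(P)}\qquad \inf_{x\in\mathscr X}\Big\{f(x)+\sup_{\mathbb Q\in\mathscr B}\mathbb E_{\mathbb Q}[g(x,w)]\Big\}$$ and the finite program, in the variables $x\in\mathbb R^n$, $\lambda\in\mathbb R^K$, $\alpha\in\mathbb R^N$ and $\psi_{l,i}\in\mathbb R^q$ for $l\in[N]$, $i\in[I]$, $$\text{(F)}\qquad \inf_{x,\lambda,\alpha,\psi}\ \Big\{f(x)+\sum_{k=1}^K\frac{N_k}{N}\Big(\lambda_k\theta_k+\sum_{l\in\Gamma_k}\frac{\alpha_l}{N_k}\Big)\Big\}$$ subject to $x\in\mathscr X$, $\lambda_k\ge 0$ for all $k\in[K]$ and, for all $l\in[N]$ and $i\in[I]$, $$\alpha_l\ge\langle a_i(x),\widehat w_l\rangle+\langle\psi_{l,i},d-C\widehat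 w_l\rangle+b_i,\qquad \|C^{T}\psi_{l,i}-a_i(x)\|_*\le\lambda_{k(l)},\qquad \psi_{l,i}\ge 0 .$$ Then (P) and (F) are equivalent: for every $x\in\mathscr X$, $g(x,\cdot)$ is integrable under every $\mathbb Q\in\mathscr B$, and $\sup_{\mathbb Q\in\mathscr B}\mathbb E_{\mathbb Q}[g(x,w)]$ is the minimum, and is attained as such, of $\sum_{k}\frac{N_k}{N}\big(\lambda_k\theta_k+\sum_{l\in\Gamma_k}\frac{\alpha_l}{N_k}\big)$ over all $(\lambda,\alpha,\psi)$ for which $(x,\lambda,\alpha,\psi)$ is feasible in (F). Consequently (P) and (F) have the same optimal value in $\mathbb R\cup\{\pm\infty\}$, and $x$ is an optimal solution of (P) if and only if $(x,\lambda,\alpha,\psi)$ is an optimal solution of (F) for some $(\lambda,\alpha,\psi)$. -/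

import Mathlib

open MeasureTheory Matrix

noncomputable section

namespace BNWDRO

/-- A seminorm on `ℝ^m` that is a norm. -/
def IsNorm {m : ℕ} (nrm : Seminorm ℝ (Fin m → ℝ)) : Prop :=
  ∀ w, nrm w = 0 → w = 0

/-- The dual norm `‖z‖_* = sup {⟨z, w⟩ : ‖w‖ ≤ 1}`. -/
def dualNorm {m : ℕ} (nrm : Seminorm ℝ (Fin m → ℝ)) (z : Fin m → ℝ) : ℝ :=
  sSup ((fun w => z ⬝ᵥ w) '' {w | nrm w ≤ 1})

/-- The polyhedron `{w : C w ≤ d}`, the inequality being componentwise. -/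
def polyhedron {m q : ℕ} (C : Matrix (Fin q) (Fin m) ℝ) (d : Fin q → ℝ) : Set (Fin m → ℝ) :=
  {w | C *ᵥ w ≤ d}

/-- The Wasserstein distance
`inf {∫ ‖x - y‖ dπ(x, y) : π has marginals Q and P}`, with values in `[0, ∞]`. -/
def wassersteinDist {m : ℕ} (nrm : Seminorm ℝ (Fin m → ℝ))
    (Q P : Measure (Fin m → ℝ)) : ENNReal :=
  ⨅ π ∈ {π : Measure ((Fin m → ℝ) × (Fin m → ℝ)) | π.fst = Q ∧ π.snd = P},
    ∫⁻ p, ENNReal.ofReal (nrm (p.1 - p.2)) ∂π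

/-- The Wasserstein ball of radius `θ` around `P`, among the Borel probability measures
supported on `Ξ`. -/
def wassersteinBall {m : ℕ} (nrm : Seminorm ℝ (Fin m → ℝ)) (Ξ : Set (Fin m → ℝ))
    (θ : ℝ) (P : Measure (Fin m → ℝ)) : Set (Measure (Fin m → ℝ)) :=
  {Q | IsProbabilityMeasure Q ∧ Q Ξᶜ = 0 ∧ wassersteinDist nrm Q P ≤ ENNReal.ofReal θ}

/-- The `k`-th cluster (as a set of data indices) for the clustering labels `z`. -/
def cluster {N K : ℕ} (z : Fin N → Fin K) (k : Fin K) : Finset (Fin N) :=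
  Finset.univ.filter (fun l => z l = k)

/-- The empirical distribution of the `k`-th cluster of the data `wh`. -/
def localEmpirical {m N K : ℕ} (wh : Fin N → Fin m → ℝ) (z : Fin N → Fin K) (k : Fin K) :
    Measure (Fin m → ℝ) :=
  ((cluster z k).card : ENNReal)⁻¹ • ∑ l ∈ cluster z k, Measure.dirac (wh l)

/-- The ambiguity set: the Minkowski sum over the clusters `k` of the local Wasserstein balls
of radii `θ k`, weighted by the relative sizes of the clusters. -/
def ambiguitySet {m N K : ℕ} (nrm : Seminorm ℝ (Fin m → ℝ)) (Ξ : Set (Fin m → ℝ))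
    (wh : Fin N → Fin m → ℝ) (z : Fin N → Fin K) (θ : Fin K → ℝ) :
    Set (Measure (Fin m → ℝ)) :=
  {Q | ∃ Qk : Fin K → Measure (Fin m → ℝ),
    (∀ k, Qk k ∈ wassersteinBall nrm Ξ (θ k) (localEmpirical wh z k)) ∧
    Q = ∑ k, (((cluster z k).card : ENNReal) / (N : ENNReal)) • Qk k}

/-- The worst-case expectation `sup {E_Q[g] : Q ∈ B}` over a set `B` of measures. -/
def worstCase {m : ℕ} (B : Set (Measure (Fin m → ℝ))) (g : (Fin m → ℝ) → ℝ) : EReal :=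
  ⨆ Q ∈ B, ((∫ w, g w ∂Q : ℝ) : EReal)

/-- The objective `x ↦ f(x) + sup {E_Q[g(x, ·)] : Q ∈ B}` of the robust problem. -/
def robustObjective {n m : ℕ} (f : (Fin n → ℝ) → EReal)
    (g : (Fin n → ℝ) → (Fin m → ℝ) → ℝ) (B : Set (Measure (Fin m → ℝ)))
    (x : Fin n → ℝ) : EReal :=
  f x + worstCase B (g x)

/-- The loss `g(x, w) = max_i (⟨a_i(x), w⟩ + b_i)`. -/
def maxAffineLoss {n m I : ℕ} (a : Fin I → (Fin n → ℝ) → (Fin m → ℝ)) (b : Fin I → ℝ)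
    (x : Fin n → ℝ) (w : Fin m → ℝ) : ℝ :=
  ⨆ i, (a i x ⬝ᵥ w + b i)

/-- The decision variables `(x, λ, α, ψ)` of the finite program. -/
structure ProgramVar (n N K I q : ℕ) where
  /-- the decision -/
  x : Fin n → ℝ
  /-- one multiplier per cluster -/
  lam : Fin K → ℝ
  /-- one epigraph variable per data point -/
  alpha : Fin N → ℝ
  /-- one vector of multipliers per data point and per affine piece -/
  psi : Fin N → Fin I → Fin q → ℝ

/-- The feasible set of the finite program. -/
def programFeasible {n m N K I q : ℕ} (nrm : Seminorm ℝ (Fin m → ℝ)) (X : Set (Fin n → ℝ))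
    (C : Matrix (Fin q) (Fin m) ℝ) (d : Fin q → ℝ)
    (a : Fin I → (Fin n → ℝ) → (Fin m → ℝ)) (b : Fin I → ℝ)
    (wh : Fin N → Fin m → ℝ) (z : Fin N → Fin K) : Set (ProgramVar n N K I q) :=
  {p | p.x ∈ X ∧ (∀ k, 0 ≤ p.lam k) ∧ (∀ l i, 0 ≤ p.psi l i) ∧
    (∀ l i, a i p.x ⬝ᵥ wh l + p.psi l i ⬝ᵥ (d - C *ᵥ wh l) + b i ≤ p.alpha l) ∧
    (∀ k, ∀ l ∈ cluster z k, ∀ i, dualNorm nrm (Cᵀ *ᵥ p.psi l i - a i p.x) ≤ p.lam k)}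

/-- The part `∑_k |Γ_k|/N (λ_k θ_k + ∑_{l ∈ Γ_k} α_l/|Γ_k|)` of the objective of the
finite program. -/
def programCost {n N K I q : ℕ} (z : Fin N → Fin K) (θ : Fin K → ℝ)
    (p : ProgramVar n N K I q) : ℝ :=
  ∑ k, ((cluster z k).card : ℝ) / (N : ℝ) *
    (p.lam k * θ k + ∑ l ∈ cluster z k, p.alpha l / ((cluster z k).card : ℝ))

/-- The objective of the finite program. -/
def programObjective {n N K I q : ℕ} (f : (Fin n → ℝ) → EReal) (z : Fin N → Fin K)
    (θ : Fin K → ℝ) (p : ProgramVar n N K I q) : EReal :=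
  f p.x + (programCost z θ p : EReal)

end BNWDRO

end

namespace BNWDRO

/-! A measure in the ambiguity set is a mixture of independently chosen `Q_k`, so the worst case
splits into one Wasserstein problem per cluster. Weak duality: if `g u ≤ r ‖u - ŵ_l‖ + α_l` on `Ξ`
for all `l` in a cluster, integrating against a near-optimal coupling bounds the expectation by `r
θ` plus the mean of the `α_l` (`integral_le_of_mem_wassersteinBall`). Strong duality
(`exists_dual_solution`) needs no minimax theorem. The optimal value `V c` over couplings of cost at
most `c` is concave and nondecreasing, so it has a supergradient `r ≥ 0` at `θ`. Moving each atom
`ŵ_l` to an arbitrary `w_l ∈ Ξ` gives a coupling, and the supergradient inequality for its cost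
reads `r θ + mean (g w_l - r ‖w_l - ŵ_l‖) ≤ V θ`. Taking suprema over each `w_l` separately produces
the `α_l`. For each affine piece, `exists_multiplier_of_affine_le` turns the constraint on `u ∈ Ξ`
into the multiplier `ψ`: Hahn-Banach separates the norm part from the polyhedral part, and Farkas'
lemma handles the latter. The dual is thus attained, while the primal is only approached. -/

/-! ### Norms on `ℝ^m` and their duals. -/

theorem continuous_seminorm {m : ℕ} (nrm : Seminorm ℝ (Fin m → ℝ)) : Continuous nrm := by
  have h := nrm.convexOn.continuousOn_interior
  rwa [interior_univ, continuousOn_univ] at h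

/-- Compactness of the unit sphere: `nrm` is continuous and positive there, so its minimum is
positive. -/
theorem IsNorm.exists_norm_le {m : ℕ} {nrm : Seminorm ℝ (Fin m → ℝ)} (hnrm : IsNorm nrm) :
    ∃ c : ℝ, 0 ≤ c ∧ ∀ w, ‖w‖ ≤ c * nrm w := by
  rcases (Metric.sphere (0 : Fin m → ℝ) 1).eq_empty_or_nonempty with he | hne
  · refine ⟨0, le_rfl, fun w => ?_⟩
    by_contra! hw
    have hw0 : ‖w‖ ≠ 0 := by rintro h; simp [h] at hw
    have : ‖w‖⁻¹ • w ∈ Metric.sphere (0 : Fin m → ℝ) 1 := by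
      simp [norm_smul, hw0]
    simp [he] at this
  · obtain ⟨w₀, hw₀, hmin⟩ := (isCompact_sphere (0 : Fin m → ℝ) 1).exists_isMinOn hne
      (continuous_seminorm nrm).continuousOn
    have hpos : 0 < nrm w₀ := by
      refine lt_of_le_of_ne (apply_nonneg _ _) fun h => ?_
      rw [hnrm w₀ h.symm] at hw₀
      simp at hw₀
    refine ⟨(nrm w₀)⁻¹, by positivity, fun w => ?_⟩
    rcases eq_or_ne w 0 with rfl | hw
    · simp
    have hw0 : 0 < ‖w‖ := norm_pos_iff.2 hw
    have h1 : nrm w₀ ≤ nrm (‖w‖⁻¹ • w) := hmin (by simp [norm_smul, hw0.ne'])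
    rw [map_smul_eq_mul, norm_inv, norm_norm, ← div_eq_inv_mul, le_div_iff₀ hw0] at h1
    rw [← div_eq_inv_mul, le_div_iff₀ hpos]
    linarith

theorem IsNorm.exists_dotProduct_le {m : ℕ} {nrm : Seminorm ℝ (Fin m → ℝ)} (hnrm : IsNorm nrm)
    (z : Fin m → ℝ) : ∃ L : ℝ, 0 ≤ L ∧ ∀ w, z ⬝ᵥ w ≤ L * nrm w := by
  obtain ⟨c, hc, h⟩ := hnrm.exists_norm_le
  refine ⟨(∑ i, |z i|) * c, by positivity, fun w => ?_⟩
  have h1 : z ⬝ᵥ w ≤ (∑ i, |z i|) * ‖w‖ := by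
    rw [dotProduct, Finset.sum_mul]
    refine Finset.sum_le_sum fun i _ => (le_abs_self _).trans ?_
    rw [abs_mul]
    exact mul_le_mul_of_nonneg_left (norm_le_pi_norm w i) (abs_nonneg _)
  calc z ⬝ᵥ w ≤ _ := h1
    _ ≤ (∑ i, |z i|) * (c * nrm w) := by gcongr; exact h w
    _ = _ := by ring

theorem dualNorm_le {m : ℕ} {nrm : Seminorm ℝ (Fin m → ℝ)} {z : Fin m → ℝ} {r : ℝ} (hr : 0 ≤ r)
    (h : ∀ w, z ⬝ᵥ w ≤ r * nrm w) : dualNorm nrm z ≤ r := by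
  refine csSup_le ⟨_, 0, by simp, rfl⟩ ?_
  rintro _ ⟨w, hw, rfl⟩
  exact (h w).trans (mul_le_of_le_one_right hr hw)

/-- Scale `w` to unit length. The supremum in `dualNorm` must first be shown bounded, since a real
`sSup` of an unbounded set is `0`. -/
theorem IsNorm.dotProduct_le {m : ℕ} {nrm : Seminorm ℝ (Fin m → ℝ)} (hnrm : IsNorm nrm)
    {z : Fin m → ℝ} {r : ℝ} (h : dualNorm nrm z ≤ r) (w : Fin m → ℝ) : z ⬝ᵥ w ≤ r * nrm w := by
  rcases (apply_nonneg nrm w).eq_or_lt with h0 | h0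
  · rw [hnrm w h0.symm]; simp
  obtain ⟨L, hL, hzL⟩ := hnrm.exists_dotProduct_le z
  have hb : BddAbove ((fun w => z ⬝ᵥ w) '' {w | nrm w ≤ 1}) := by
    refine ⟨L, ?_⟩
    rintro _ ⟨w, hw, rfl⟩
    exact (hzL w).trans (mul_le_of_le_one_right hL hw)
  have h1 := (le_csSup hb ⟨(nrm w)⁻¹ • w, by
    simp [map_smul_eq_mul, abs_of_pos h0, h0.ne'], rfl⟩).trans h
  simp only [dotProduct_smul, smul_eq_mul] at h1
  rwa [← div_eq_inv_mul, div_le_iff₀ h0] at h1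

/-! ### Farkas' lemma, separation, and multipliers for a single affine piece. -/

/-- **Farkas' lemma** for finitely many linear functionals on a real vector space. -/
theorem exists_eq_sum_smul_of_forall_nonpos {ι V : Type*} [AddCommGroup V] [Module ℝ V]
    (s : Finset ι) (A : ι → V →ₗ[ℝ] ℝ) (e : V →ₗ[ℝ] ℝ)
    (h : ∀ x, (∀ i ∈ s, A i x ≤ 0) → e x ≤ 0) :
    ∃ ψ : ι → ℝ, (∀ i, 0 ≤ ψ i) ∧ e = ∑ i ∈ s, ψ i • A i := by
  classical
  induction s using Finset.induction_on generalizing A e with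
  | empty =>
    refine ⟨0, by simp, ?_⟩
    ext x
    have h1 := h x (by simp)
    have h2 := h (-x) (by simp)
    simp only [map_neg] at h2
    simp only [Finset.sum_empty, LinearMap.zero_apply]
    linarith
  | insert j s hj ih =>
    by_cases hs : ∀ x, (∀ i ∈ s, A i x ≤ 0) → e x ≤ 0
    · obtain ⟨ψ, hψ, he⟩ := ih A e hs
      refine ⟨Function.update ψ j 0, fun i => ?_, ?_⟩
      · rcases eq_or_ne i j with rfl | hij
        · simp
        · simp [hij, hψ]
      · rw [Finset.sum_insert hj, he]
        simp only [Function.update_self, zero_smul, zero_add]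
        refine Finset.sum_congr rfl fun i hi => ?_
        rw [Function.update_of_ne (by rintro rfl; exact hj hi)]
    · push Not at hs
      obtain ⟨y, hy, hey⟩ := hs
      have hjy : 0 < A j y := by
        by_contra! hle
        exact absurd (h y (by simpa using ⟨hle, hy⟩)) (not_le.2 hey)
      -- If `A j` cannot be dropped, some `x₀` violates the conclusion with `A j x₀ = 1`. Projecting
      -- along `x₀` onto the kernel of `A j` reduces to the functionals in `s`.
      obtain ⟨x₀, hx₀, hex₀, hjx₀⟩ : ∃ x₀, (∀ i ∈ s, A i x₀ ≤ 0) ∧ 0 < e x₀ ∧ A j x₀ = 1 :=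
        ⟨(A j y)⁻¹ • y, fun i hi => by
          simpa using mul_nonpos_of_nonneg_of_nonpos (inv_nonneg.2 hjy.le) (hy i hi),
          by simpa using mul_pos (inv_pos.2 hjy) hey, by simp [hjy.ne']⟩
      obtain ⟨ψ, hψ, he⟩ := ih (fun i => A i - A i x₀ • A j) (e - e x₀ • A j) (by
        intro x hx
        have := h (x - A j x • x₀) (by
          intro i hi
          rcases Finset.mem_insert.1 hi with rfl | hi
          · simp [hjx₀]
          · have := hx i hi
            simp only [LinearMap.sub_apply, LinearMap.smul_apply, smul_eq_mul, map_sub,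
              map_smul] at this ⊢
            linarith)
        simp only [LinearMap.sub_apply, LinearMap.smul_apply, smul_eq_mul, map_sub,
          map_smul] at this ⊢
        linarith)
      -- The coefficient of `A j` is forced by evaluating at `x₀`; it is nonnegative because `e x₀ >
      -- 0` and every `A i x₀ ≤ 0`.
      refine ⟨Function.update ψ j (e x₀ - ∑ i ∈ s, ψ i * A i x₀), fun i => ?_, ?_⟩
      · rcases eq_or_ne i j with rfl | hij
        · have : ∑ l ∈ s, ψ l * A l x₀ ≤ 0 :=
            Finset.sum_nonpos fun l hl => mul_nonpos_of_nonneg_of_nonpos (hψ l) (hx₀ l hl)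
          simp only [Function.update_self]
          linarith
        · simp [hij, hψ]
      · rw [Finset.sum_insert hj, Function.update_self]
        have : ∑ i ∈ s, Function.update ψ j (e x₀ - ∑ i ∈ s, ψ i * A i x₀) i • A i
            = ∑ i ∈ s, ψ i • A i := Finset.sum_congr rfl fun i hi => by
          rw [Function.update_of_ne (by rintro rfl; exact hj hi)]
        rw [this]
        ext x
        have hx := LinearMap.congr_fun he x
        simp only [LinearMap.sub_apply, LinearMap.smul_apply, smul_eq_mul, LinearMap.sum_apply,
          mul_sub, Finset.sum_sub_distrib, LinearMap.add_apply] at hx ⊢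
        simp only [← mul_assoc, ← Finset.sum_mul] at hx
        linarith

/-- The affine form of Farkas' lemma, for a system that has the origin as a solution. -/
theorem exists_multiplier_of_forall_le {m q : ℕ} (C : Matrix (Fin q) (Fin m) ℝ) (s : Fin q → ℝ)
    (hs : 0 ≤ s) (e : Fin m → ℝ) (β : ℝ) (h : ∀ w, C *ᵥ w ≤ s → e ⬝ᵥ w ≤ β) :
    ∃ ψ : Fin q → ℝ, 0 ≤ ψ ∧ Cᵀ *ᵥ ψ = e ∧ ψ ⬝ᵥ s ≤ β := by
  -- Recession directions: a positive value of `e` along one could be scaled up to `β + 1`.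
  have hrec : ∀ w, C *ᵥ w ≤ 0 → e ⬝ᵥ w ≤ 0 := by
    intro w hw
    by_contra! hpos
    have hβ : 0 ≤ β := by simpa using h 0 (by simpa using hs)
    have := h (((β + 1) / (e ⬝ᵥ w)) • w) (by
      rw [mulVec_smul]
      exact (smul_nonpos_of_nonneg_of_nonpos (by positivity) hw).trans hs)
    rw [dotProduct_smul, smul_eq_mul, div_mul_cancel₀ _ hpos.ne'] at this
    linarith
  -- Homogenize with an extra coordinate `t ≥ 0`, the constraint indexed by `none`. The case `t = 0`
  -- is `hrec`; the case `t > 0` rescales to `h`.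
  let A : Option (Fin q) → ((Fin m → ℝ) × ℝ) →ₗ[ℝ] ℝ := fun o =>
    o.elim (-LinearMap.snd ℝ _ _) fun j =>
      (LinearMap.proj j ∘ₗ C.mulVecLin) ∘ₗ LinearMap.fst ℝ _ _ - s j • LinearMap.snd ℝ _ _
  let E : ((Fin m → ℝ) × ℝ) →ₗ[ℝ] ℝ :=
    (dotProductBilin ℝ ℝ e) ∘ₗ LinearMap.fst ℝ _ _ - β • LinearMap.snd ℝ _ _
  have hA : ∀ j w t, A (some j) (w, t) = (C *ᵥ w) j - s j * t := fun j w t => rfl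
  have hA' : ∀ w t, A none (w, t) = - t := fun w t => rfl
  have hE : ∀ w t, E (w, t) = e ⬝ᵥ w - β * t := fun w t => rfl
  obtain ⟨ψ, hψ, he⟩ := exists_eq_sum_smul_of_forall_nonpos Finset.univ A E (by
    rintro ⟨w, t⟩ hw
    have h0 := hw none (Finset.mem_univ _)
    have h1 := fun j => hw (some j) (Finset.mem_univ _)
    simp only [hA, hA', hE] at h0 h1 ⊢
    rcases (neg_nonpos.1 h0).eq_or_lt with rfl | ht
    · simpa using hrec w fun j => by simpa using h1 j
    · have := h (t⁻¹ • w) fun j => by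
        rw [mulVec_smul, Pi.smul_apply, smul_eq_mul, inv_mul_le_iff₀ ht]
        linarith [h1 j]
      rw [dotProduct_smul, smul_eq_mul, inv_mul_le_iff₀ ht] at this
      linarith)
  have key : ∀ w t, e ⬝ᵥ w - β * t
      = ψ none * (-t) + ∑ j, ψ (some j) * ((C *ᵥ w) j - s j * t) := by
    intro w t
    rw [← hE, he]
    simp [Fintype.sum_option, hA, hA']
  refine ⟨fun j => ψ (some j), fun j => hψ _, ?_, ?_⟩
  · ext i
    have := key (Pi.single i 1) 0
    simp only [dotProduct_single, mul_one, mul_zero, sub_zero, neg_zero, zero_add,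
      mulVec_single_one, col_apply] at this
    rw [this, mulVec, dotProduct]
    simp [mul_comm]
  · have := key 0 1
    simp only [dotProduct_zero, mulVec_zero, Pi.zero_apply, mul_one, zero_sub,
      mul_neg, Finset.sum_neg_distrib] at this
    have h0 := hψ none
    rw [dotProduct]
    linarith

/-- A linear function that is dominated by `r ‖·‖ + β` on a convex set containing the origin splits
into a part dominated by `r ‖·‖` and a part dominated by `β` on the set. -/
theorem exists_dotProduct_le_of_forall_le {m : ℕ} (nrm : Seminorm ℝ (Fin m → ℝ))
    {S : Set (Fin m → ℝ)} (hS : Convex ℝ S) (h0 : 0 ∈ S) (a : Fin m → ℝ) {r β : ℝ} (hr : 0 ≤ r)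
    (h : ∀ w ∈ S, a ⬝ᵥ w ≤ r * nrm w + β) :
    ∃ y : Fin m → ℝ, (∀ w, y ⬝ᵥ w ≤ r * nrm w) ∧ ∀ w ∈ S, (a - y) ⬝ᵥ w ≤ β := by
  have hβ : 0 ≤ β := by simpa using h 0 h0
  -- Separate the open strict epigraph of `r ‖·‖` from the graph of `w ↦ a ⬝ᵥ w - β` over `S`.
  let U : Set ((Fin m → ℝ) × ℝ) := {p | r * nrm p.1 < p.2}
  let T : Set ((Fin m → ℝ) × ℝ) := {p | p.1 ∈ S ∧ p.2 = a ⬝ᵥ p.1 - β}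
  have hU : Convex ℝ U := by
    have := (nrm.convexOn.smul hr).convex_strict_epigraph
    simpa [U] using this
  have hUo : IsOpen U := isOpen_lt
    (((continuous_seminorm nrm).comp continuous_fst).const_mul _) continuous_snd
  have hT : Convex ℝ T := by
    rintro ⟨w, t⟩ ⟨hw, ht⟩ ⟨w', t'⟩ ⟨hw', ht'⟩ c c' hc hc' hcc
    refine ⟨hS hw hw' hc hc' hcc, ?_⟩
    simp only [Prod.smul_mk, Prod.mk_add_mk, smul_eq_mul, dotProduct_add, dotProduct_smul] at *
    rw [ht, ht']
    linear_combination (-β) * hcc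
  have hd : Disjoint U T := by
    rw [Set.disjoint_left]
    rintro ⟨w, t⟩ h1 ⟨h2, h3⟩
    have := h w h2
    simp only [U, Set.mem_ofPred_eq] at h1 h3
    linarith
  obtain ⟨φ, u, hφU, hφT⟩ := geometric_hahn_banach_open hU hUo hT hd
  let η : Fin m → ℝ := fun i => φ (Pi.single i 1, 0)
  let τ : ℝ := φ (0, 1)
  have hφ : ∀ w t, φ (w, t) = η ⬝ᵥ w + τ * t := by
    intro w t
    have h1 : φ (w, t) = φ (w, 0) + t * φ (0, 1) := by
      rw [← smul_eq_mul, ← map_smul, ← map_add]; simp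
    have h2 : φ (w, 0) = η ⬝ᵥ w := by
      have : (φ.toLinearMap ∘ₗ LinearMap.inl ℝ (Fin m → ℝ) ℝ) w = η ⬝ᵥ w := by
        rw [LinearMap.pi_apply_eq_sum_univ _ w, dotProduct]
        refine Finset.sum_congr rfl fun i _ => ?_
        simp only [η, smul_eq_mul, LinearMap.comp_apply, LinearMap.inl_apply]
        rw [mul_comm]
        refine congrArg (fun v => φ (v, 0) * w i) (funext fun j => ?_)
        simp [Pi.single_apply, eq_comm]
      simpa using this
    rw [h1, h2, mul_comm]
  simp only [U, T, Set.mem_ofPred_eq, Prod.forall, hφ] at hφU hφT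
  have hτ : τ < 0 := by
    have h1 := hφU 0 1 (by simp)
    have h2 := hφT 0 (-β) ⟨h0, by simp⟩
    simp only [dotProduct_zero, zero_add] at h1 h2
    by_contra! hτ
    nlinarith
  -- The bound extends to the boundary of `U`: otherwise raise the point by the excess over `u`
  -- divided by `-τ`, landing inside `U` with value exactly `u`.
  have hup : ∀ w, η ⬝ᵥ w + τ * (r * nrm w) ≤ u := by
    intro w
    by_contra! hlt
    have := hφU w (r * nrm w + (η ⬝ᵥ w + τ * (r * nrm w) - u) / (-τ)) (by
      have : 0 < (η ⬝ᵥ w + τ * (r * nrm w) - u) / (-τ) := div_pos (by linarith) (by linarith)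
      linarith)
    have h2 : τ * ((η ⬝ᵥ w + τ * (r * nrm w) - u) / (-τ)) = -(η ⬝ᵥ w + τ * (r * nrm w) - u) := by
      rw [mul_div_assoc', div_neg, mul_div_cancel_left₀ _ hτ.ne]
    rw [mul_add, h2] at this
    linarith
  have hu : 0 ≤ u := by simpa using hup 0
  -- The left side is positively homogeneous, so being bounded above by `u` forces it to be
  -- nonpositive.
  have hhom : ∀ w, η ⬝ᵥ w + τ * (r * nrm w) ≤ 0 := by
    intro w
    by_contra! hpos
    have := hup (((u + 1) / (η ⬝ᵥ w + τ * (r * nrm w))) • w)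
    have hc : 0 < (u + 1) / (η ⬝ᵥ w + τ * (r * nrm w)) := by positivity
    rw [dotProduct_smul, map_smul_eq_mul, smul_eq_mul, Real.norm_of_nonneg hc.le] at this
    have h2 : (u + 1) / (η ⬝ᵥ w + τ * (r * nrm w)) * (η ⬝ᵥ w + τ * (r * nrm w)) = u + 1 :=
      div_mul_cancel₀ _ hpos.ne'
    nlinarith
  have hτ' : 0 < -τ := by linarith
  refine ⟨(-τ)⁻¹ • η, fun w => ?_, fun w hw => ?_⟩
  · rw [smul_dotProduct, smul_eq_mul, inv_mul_le_iff₀ hτ']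
    linarith [hhom w]
  · have h1 := hφT w _ ⟨hw, rfl⟩
    have h2 : (-τ) * ((a - (-τ)⁻¹ • η) ⬝ᵥ w - β) ≤ 0 := by
      rw [sub_dotProduct, smul_dotProduct, smul_eq_mul]
      have : (-τ) * (a ⬝ᵥ w - (-τ)⁻¹ * (η ⬝ᵥ w) - β)
          = -(η ⬝ᵥ w + τ * (a ⬝ᵥ w - β)) := by
        linear_combination (-(η ⬝ᵥ w)) * mul_inv_cancel₀ hτ'.ne'
      rw [this]
      linarith
    linarith [nonpos_of_mul_nonpos_right h2 hτ']

/-- Dualization of an affine robust constraint with a norm penalty over a polyhedron. -/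
theorem exists_multiplier_of_affine_le {m q : ℕ} (nrm : Seminorm ℝ (Fin m → ℝ))
    (C : Matrix (Fin q) (Fin m) ℝ) (d : Fin q → ℝ) {w₀ : Fin m → ℝ} (hw₀ : w₀ ∈ polyhedron C d)
    (a : Fin m → ℝ) (b : ℝ) {r α : ℝ} (hr : 0 ≤ r)
    (h : ∀ w ∈ polyhedron C d, a ⬝ᵥ w + b ≤ r * nrm (w - w₀) + α) :
    ∃ ψ : Fin q → ℝ, 0 ≤ ψ ∧ a ⬝ᵥ w₀ + ψ ⬝ᵥ (d - C *ᵥ w₀) + b ≤ α ∧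
      dualNorm nrm (Cᵀ *ᵥ ψ - a) ≤ r := by
  have hs : (0 : Fin q → ℝ) ≤ d - C *ᵥ w₀ := sub_nonneg.2 hw₀
  obtain ⟨y, hy, hay⟩ := exists_dotProduct_le_of_forall_le nrm
    (S := {w | C *ᵥ w ≤ d - C *ᵥ w₀}) (a := a) (r := r) (β := α - a ⬝ᵥ w₀ - b)
    (by
      have := (convex_Iic (d - C *ᵥ w₀)).linear_preimage C.mulVecLin
      simpa [Set.preimage] using this)
    (by simpa [polyhedron] using hw₀) hr (by
      intro w hw
      have := h (w + w₀) (by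
        show C *ᵥ (w + w₀) ≤ d
        rw [mulVec_add]
        exact le_sub_iff_add_le.1 hw)
      rw [add_sub_cancel_right, dotProduct_add] at this
      linarith)
  obtain ⟨ψ, hψ, hCψ, hψs⟩ := exists_multiplier_of_forall_le C _ hs (a - y) _ hay
  refine ⟨ψ, hψ, by linarith, dualNorm_le hr fun w => ?_⟩
  have := hy (-w)
  rw [map_neg_eq_map, dotProduct_neg] at this
  rwa [hCψ, sub_sub_cancel_left, neg_dotProduct]

/-! ### Lipschitz losses. -/

/-- `g` is Lipschitz, with constant `L`, for the seminorm `nrm`. -/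
def SeminormLipschitz {m : ℕ} (nrm : Seminorm ℝ (Fin m → ℝ)) (L : ℝ) (g : (Fin m → ℝ) → ℝ) :
    Prop :=
  ∀ u v, g u ≤ g v + L * nrm (u - v)

theorem SeminormLipschitz.continuous {m : ℕ} {nrm : Seminorm ℝ (Fin m → ℝ)} {L : ℝ}
    {g : (Fin m → ℝ) → ℝ} (hg : SeminormLipschitz nrm L g) : Continuous g := by
  rw [continuous_iff_continuousAt]
  intro v
  have h : Filter.Tendsto (fun u => L * nrm (u - v)) (nhds v) (nhds 0) := by
    have : Continuous fun u => L * nrm (u - v) :=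
      ((continuous_seminorm nrm).comp (continuous_id.sub continuous_const)).const_mul _
    simpa using this.tendsto v
  refine tendsto_iff_dist_tendsto_zero.2 (squeeze_zero (fun _ => dist_nonneg) (fun u => ?_) h)
  rw [Real.dist_eq, abs_sub_le_iff]
  have h1 := hg u v
  have h2 := hg v u
  rw [map_sub_rev] at h2
  constructor <;> linarith

theorem SeminormLipschitz.abs_le {m : ℕ} {nrm : Seminorm ℝ (Fin m → ℝ)} {L : ℝ}
    {g : (Fin m → ℝ) → ℝ} (hg : SeminormLipschitz nrm L g) (u v : Fin m → ℝ) :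
    |g u| ≤ L * nrm (u - v) + |g v| := by
  have h1 := hg u v
  have h2 := hg v u
  rw [map_sub_rev] at h2
  rw [_root_.abs_le]
  constructor <;> linarith [le_abs_self (g v), neg_abs_le (g v)]

theorem IsNorm.exists_seminormLipschitz_maxAffineLoss {n m I : ℕ} [NeZero I]
    {nrm : Seminorm ℝ (Fin m → ℝ)} (hnrm : IsNorm nrm) (a : Fin I → (Fin n → ℝ) → (Fin m → ℝ))
    (b : Fin I → ℝ) (x : Fin n → ℝ) :
    ∃ L, 0 ≤ L ∧ SeminormLipschitz nrm L (maxAffineLoss a b x) := by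
  choose L hL h using fun i => hnrm.exists_dotProduct_le (a i x)
  refine ⟨∑ i, L i, Finset.sum_nonneg fun i _ => hL i, fun u v => ciSup_le fun i => ?_⟩
  have h1 := h i (u - v)
  have h2 : L i * nrm (u - v) ≤ (∑ i, L i) * nrm (u - v) := by
    gcongr
    exact Finset.single_le_sum (fun i _ => hL i) (Finset.mem_univ i)
  have h3 : a i x ⬝ᵥ v + b i ≤ maxAffineLoss a b x v :=
    le_ciSup (f := fun i => a i x ⬝ᵥ v + b i) (Set.finite_range _).bddAbove i
  rw [dotProduct_sub] at h1
  linarith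

/-! ### Uniform distributions on finite families. -/

/-- The uniform distribution on the points `p l`, `l ∈ Γ`. -/
noncomputable def uniformOn {ι E : Type*} [MeasurableSpace E] (Γ : Finset ι) (p : ι → E) : Measure E :=
  (Γ.card : ENNReal)⁻¹ • ∑ l ∈ Γ, Measure.dirac (p l)

section uniformOn

variable {ι E : Type*} [MeasurableSpace E] {Γ : Finset ι}

theorem isProbabilityMeasure_uniformOn (hΓ : Γ.Nonempty) (p : ι → E) :
    IsProbabilityMeasure (uniformOn Γ p) := by
  constructor
  simp only [uniformOn, Measure.smul_apply, Measure.finsetSum_apply, measure_univ, smul_eq_mul,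
    Finset.sum_const, nsmul_eq_mul, mul_one]
  exact ENNReal.inv_mul_cancel (by simpa using hΓ.ne_empty) (by simp)

theorem map_uniformOn {E' : Type*} [MeasurableSpace E'] (p : ι → E) {φ : E → E'}
    (hφ : Measurable φ) : (uniformOn Γ p).map φ = uniformOn Γ (φ ∘ p) := by
  rw [uniformOn, Measure.map_smul, ← Measure.mapₗ_apply_of_measurable hφ, map_sum]
  simp [Measure.mapₗ_apply_of_measurable hφ, Measure.map_dirac' hφ, uniformOn]

theorem integrable_uniformOn [MeasurableSingletonClass E] (hΓ : Γ.Nonempty) (p : ι → E)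
    (φ : E → ℝ) : Integrable φ (uniformOn Γ p) := by
  refine Integrable.smul_measure ?_ (by simpa using hΓ.ne_empty)
  rw [integrable_finsetSum_measure]
  exact fun l _ => integrable_dirac (by simp)

theorem integral_uniformOn [MeasurableSingletonClass E] (p : ι → E) (φ : E → ℝ) :
    ∫ y, φ y ∂(uniformOn Γ p) = ∑ l ∈ Γ, φ (p l) / Γ.card := by
  rw [uniformOn, integral_smul_measure, integral_finsetSum_measure]
  · simp [integral_dirac, Finset.mul_sum, div_eq_inv_mul]
  · exact fun l _ => integrable_dirac (by simp)

theorem lintegral_uniformOn_ofReal [MeasurableSingletonClass E] (hΓ : Γ.Nonempty) (p : ι → E)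
    (φ : E → ℝ) (h : ∀ y, 0 ≤ φ y) :
    ∫⁻ y, ENNReal.ofReal (φ y) ∂(uniformOn Γ p)
      = ENNReal.ofReal (∑ l ∈ Γ, φ (p l) / Γ.card) := by
  rw [← ofReal_integral_eq_lintegral_ofReal (integrable_uniformOn hΓ p φ)
    (Filter.Eventually.of_forall h), integral_uniformOn]

end uniformOn

/-! ### Couplings and weak duality. -/

section couplings

variable {m : ℕ} {ι : Type*}

/-- The couplings of a probability measure supported on `Ξ` with `P` of cost at most `c`. -/
def couplings (nrm : Seminorm ℝ (Fin m → ℝ)) (Ξ : Set (Fin m → ℝ)) (P : Measure (Fin m → ℝ))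
    (c : ℝ) : Set (Measure ((Fin m → ℝ) × (Fin m → ℝ))) :=
  {π | IsProbabilityMeasure π ∧ π.snd = P ∧ π.fst Ξᶜ = 0 ∧
    ∫⁻ p, ENNReal.ofReal (nrm (p.1 - p.2)) ∂π ≤ ENNReal.ofReal c}

theorem continuous_seminorm_sub (nrm : Seminorm ℝ (Fin m → ℝ)) :
    Continuous fun p : (Fin m → ℝ) × (Fin m → ℝ) => nrm (p.1 - p.2) :=
  (continuous_seminorm nrm).comp (continuous_fst.sub continuous_snd)

variable {nrm : Seminorm ℝ (Fin m → ℝ)} {Ξ : Set (Fin m → ℝ)} {P : Measure (Fin m → ℝ)}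
  {π : Measure ((Fin m → ℝ) × (Fin m → ℝ))} {c : ℝ}

theorem couplings_mono {c' : ℝ} (h : c ≤ c') : couplings nrm Ξ P c ⊆ couplings nrm Ξ P c' :=
  fun _ ⟨h1, h2, h3, h4⟩ => ⟨h1, h2, h3, h4.trans (ENNReal.ofReal_le_ofReal h)⟩

theorem fst_mem_wassersteinBall (hπ : π ∈ couplings nrm Ξ P c) :
    π.fst ∈ wassersteinBall nrm Ξ c P := by
  obtain ⟨h1, h2, h3, h4⟩ := hπ
  exact ⟨inferInstance, h3, (iInf₂_le π ⟨rfl, h2⟩).trans h4⟩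

/-- The slack `ε` spares proving that the infimum defining the Wasserstein distance is attained. The
coupling inherits total mass one from its first marginal. -/
theorem exists_mem_couplings {Q : Measure (Fin m → ℝ)} (hc : 0 ≤ c)
    (hQ : Q ∈ wassersteinBall nrm Ξ c P) {ε : ℝ} (hε : 0 < ε) :
    ∃ π ∈ couplings nrm Ξ P (c + ε), π.fst = Q := by
  obtain ⟨h1, h2, h3⟩ := hQ
  have h4 : wassersteinDist nrm Q P < ENNReal.ofReal (c + ε) :=
    h3.trans_lt ((ENNReal.ofReal_lt_ofReal_iff (by linarith)).2 (by linarith))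
  simp only [wassersteinDist, iInf_lt_iff] at h4
  obtain ⟨π, ⟨hf, hs⟩, hlt⟩ := h4
  refine ⟨π, ⟨⟨?_⟩, hs, by rw [hf]; exact h2, hlt.le⟩, hf⟩
  rw [← Measure.fst_univ, hf]
  exact h1.measure_univ

theorem integrable_cost (hπ : π ∈ couplings nrm Ξ P c) :
    Integrable (fun p => nrm (p.1 - p.2)) π := by
  refine ⟨(continuous_seminorm_sub nrm).aestronglyMeasurable, ?_⟩
  rw [hasFiniteIntegral_iff_ofReal (Filter.Eventually.of_forall fun p => apply_nonneg _ _)]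
  exact hπ.2.2.2.trans_lt ENNReal.ofReal_lt_top

theorem integral_cost_le (hc : 0 ≤ c) (hπ : π ∈ couplings nrm Ξ P c) :
    ∫ p, nrm (p.1 - p.2) ∂π ≤ c := by
  rw [integral_eq_lintegral_of_nonneg_ae (Filter.Eventually.of_forall fun p => apply_nonneg _ _)
    (continuous_seminorm_sub nrm).aestronglyMeasurable]
  exact ENNReal.toReal_le_of_le_ofReal hc hπ.2.2.2

theorem integrable_comp_snd (hπ : π ∈ couplings nrm Ξ P c) {φ : (Fin m → ℝ) → ℝ}
    (hφ : Integrable φ P) : Integrable (fun p => φ p.2) π := by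
  rw [← hπ.2.1] at hφ
  exact hφ.comp_measurable measurable_snd

theorem integral_comp_snd (hπ : π ∈ couplings nrm Ξ P c) {φ : (Fin m → ℝ) → ℝ}
    (hφ : Continuous φ) : ∫ p, φ p.2 ∂π = ∫ v, φ v ∂P := by
  rw [← hπ.2.1, Measure.snd, integral_map measurable_snd.aemeasurable hφ.aestronglyMeasurable]

theorem integrable_comp_fst {L : ℝ} {g : (Fin m → ℝ) → ℝ} (hg : SeminormLipschitz nrm L g)
    (hgP : Integrable g P) (hπ : π ∈ couplings nrm Ξ P c) : Integrable (fun p => g p.1) π := by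
  refine Integrable.mono' (((integrable_cost hπ).const_mul L).add
    (integrable_comp_snd hπ hgP).abs) (hg.continuous.comp continuous_fst).aestronglyMeasurable
    (Filter.Eventually.of_forall fun p => ?_)
  exact hg.abs_le p.1 p.2

theorem integral_fst {g : (Fin m → ℝ) → ℝ} (hg : Continuous g) :
    ∫ u, g u ∂π.fst = ∫ p, g p.1 ∂π := by
  rw [Measure.fst, integral_map measurable_fst.aemeasurable hg.aestronglyMeasurable]

theorem integrable_of_mem_wassersteinBall {L : ℝ} {g : (Fin m → ℝ) → ℝ}
    (hg : SeminormLipschitz nrm L g) (hgP : Integrable g P) (hc : 0 ≤ c)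
    {Q : Measure (Fin m → ℝ)} (hQ : Q ∈ wassersteinBall nrm Ξ c P) : Integrable g Q := by
  obtain ⟨π, hπ, rfl⟩ := exists_mem_couplings hc hQ one_pos
  exact (integrable_map_measure hg.continuous.aestronglyMeasurable
    measurable_fst.aemeasurable).2 (integrable_comp_fst hg hgP hπ)

variable {Γ : Finset ι} {wh : ι → Fin m → ℝ}

/-- Weak duality for couplings. -/
theorem integral_comp_fst_le (hΓ : Γ.Nonempty) (hc : 0 ≤ c)
    (hπ : π ∈ couplings nrm Ξ (uniformOn Γ wh) c) {L r : ℝ} {g : (Fin m → ℝ) → ℝ}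
    (hg : SeminormLipschitz nrm L g) (hr : 0 ≤ r) {α : ι → ℝ}
    (h : ∀ l ∈ Γ, ∀ u ∈ Ξ, g u ≤ r * nrm (u - wh l) + α l) :
    ∫ p, g p.1 ∂π ≤ r * c + ∑ l ∈ Γ, α l / Γ.card := by
  -- `Φ` is a single function of the second coordinate with `Φ (wh l) ≤ α l`, and `g u ≤ r ‖u - v‖ +
  -- Φ v` for every `v` by the triangle inequality. This avoids disintegrating `π` over the atoms,
  -- some of which may coincide.
  let Φ : (Fin m → ℝ) → ℝ := fun v => Γ.inf' hΓ fun l => r * nrm (v - wh l) + α l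
  have hΦc : Continuous Φ := by
    refine Continuous.finset_inf'_apply hΓ fun l _ => ?_
    exact (((continuous_seminorm nrm).comp (continuous_id.sub continuous_const)).const_mul _).add
      continuous_const
  have hae : ∀ᵐ p ∂π, p.1 ∈ Ξ := by
    have h1 : ∀ᵐ u ∂π.fst, u ∈ Ξ := hπ.2.2.1
    exact ae_of_ae_map measurable_fst.aemeasurable h1
  have hΦi := integrable_uniformOn hΓ wh Φ
  have hle : (fun p => g p.1) ≤ᵐ[π] fun p => r * nrm (p.1 - p.2) + Φ p.2 := by
    filter_upwards [hae] with p hp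
    rw [← sub_le_iff_le_add', Finset.le_inf'_iff]
    intro l hl
    have h1 := h l hl p.1 hp
    have h2 : r * nrm (p.1 - wh l) ≤ r * (nrm (p.1 - p.2) + nrm (p.2 - wh l)) := by
      gcongr
      simpa using map_add_le_add nrm (p.1 - p.2) (p.2 - wh l)
    linarith
  have hΦi' := integrable_comp_snd hπ hΦi
  calc ∫ p, g p.1 ∂π ≤ ∫ p, (r * nrm (p.1 - p.2) + Φ p.2) ∂π :=
        integral_mono_ae (integrable_comp_fst hg (integrable_uniformOn hΓ wh g) hπ)
          (((integrable_cost hπ).const_mul r).add hΦi') hle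
    _ = r * ∫ p, nrm (p.1 - p.2) ∂π + ∑ l ∈ Γ, Φ (wh l) / Γ.card := by
        rw [integral_add ((integrable_cost hπ).const_mul r) hΦi', integral_const_mul,
          integral_comp_snd hπ hΦc, integral_uniformOn]
    _ ≤ r * c + ∑ l ∈ Γ, α l / Γ.card := by
        gcongr with l hl
        · exact integral_cost_le hc hπ
        · exact (Finset.inf'_le _ hl).trans (by simp)

/-- Weak duality for Wasserstein balls. -/
theorem integral_le_of_mem_wassersteinBall (hΓ : Γ.Nonempty) (hc : 0 ≤ c)
    {Q : Measure (Fin m → ℝ)} (hQ : Q ∈ wassersteinBall nrm Ξ c (uniformOn Γ wh)) {L r : ℝ}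
    {g : (Fin m → ℝ) → ℝ} (hg : SeminormLipschitz nrm L g) (hr : 0 ≤ r) {α : ι → ℝ}
    (h : ∀ l ∈ Γ, ∀ u ∈ Ξ, g u ≤ r * nrm (u - wh l) + α l) :
    ∫ u, g u ∂Q ≤ r * c + ∑ l ∈ Γ, α l / Γ.card := by
  have hlim : Filter.Tendsto (fun ε : ℝ => r * (c + ε) + ∑ l ∈ Γ, α l / Γ.card)
      (nhdsWithin 0 (Set.Ioi 0)) (nhds (r * (c + 0) + ∑ l ∈ Γ, α l / Γ.card)) :=
    (Continuous.tendsto (by fun_prop) 0).mono_left nhdsWithin_le_nhds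
  rw [add_zero] at hlim
  refine ge_of_tendsto hlim ?_
  filter_upwards [self_mem_nhdsWithin] with ε hε
  obtain ⟨π, hπ, rfl⟩ := exists_mem_couplings hc hQ hε
  rw [integral_fst hg.continuous]
  exact integral_comp_fst_le hΓ (add_nonneg hc (le_of_lt hε)) hπ hg hr h

/-- The worst-case expectation over the couplings of cost at most `c`. -/
noncomputable def couplingValue (nrm : Seminorm ℝ (Fin m → ℝ)) (Ξ : Set (Fin m → ℝ)) (P : Measure (Fin m → ℝ))
    (g : (Fin m → ℝ) → ℝ) (c : ℝ) : ℝ :=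
  sSup ((fun π => ∫ p, g p.1 ∂π) '' couplings nrm Ξ P c)

/-- The transport plan that sends each atom `wh l` whole to `w l`; strong duality needs only plans
of this kind as test points. -/
theorem uniformOn_mem_couplings (hΓ : Γ.Nonempty) (hΞ : MeasurableSet Ξ) {w : ι → Fin m → ℝ}
    (hw : ∀ l, w l ∈ Ξ) (hc : ∑ l ∈ Γ, nrm (w l - wh l) / Γ.card ≤ c) :
    uniformOn Γ (fun l => (w l, wh l)) ∈ couplings nrm Ξ (uniformOn Γ wh) c := by
  refine ⟨isProbabilityMeasure_uniformOn hΓ _, map_uniformOn _ measurable_snd, ?_, ?_⟩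
  · rw [Measure.fst, map_uniformOn _ measurable_fst, uniformOn]
    simp only [Measure.smul_apply, Measure.finsetSum_apply, smul_eq_mul, Function.comp_apply,
      Measure.dirac_apply' _ hΞ.compl]
    simp [hw]
  · rw [lintegral_uniformOn_ofReal hΓ _
      (fun p : (Fin m → ℝ) × (Fin m → ℝ) => nrm (p.1 - p.2)) fun p => apply_nonneg _ _]
    exact ENNReal.ofReal_le_ofReal hc

theorem convexCombo_mem_couplings {π' : Measure ((Fin m → ℝ) × (Fin m → ℝ))} {c' s t : ℝ}
    [IsProbabilityMeasure P]
    (hc : 0 ≤ c) (hc' : 0 ≤ c') (hπ : π ∈ couplings nrm Ξ P c) (hπ' : π' ∈ couplings nrm Ξ P c')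
    (hs : 0 ≤ s) (ht : 0 ≤ t) (hst : s + t = 1) :
    ENNReal.ofReal s • π + ENNReal.ofReal t • π' ∈ couplings nrm Ξ P (s * c + t * c') := by
  have h1 : ENNReal.ofReal s + ENNReal.ofReal t = 1 := by
    rw [← ENNReal.ofReal_add hs ht, hst, ENNReal.ofReal_one]
  obtain ⟨a1, a2, a3, a4⟩ := hπ
  obtain ⟨b1, b2, b3, b4⟩ := hπ'
  refine ⟨⟨by simp [h1]⟩, ?_, ?_, ?_⟩
  · rw [Measure.snd] at *
    rw [Measure.map_add _ _ measurable_snd, Measure.map_smul, Measure.map_smul, a2, b2,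
      ← add_smul, h1, one_smul]
  · rw [Measure.fst] at *
    rw [Measure.map_add _ _ measurable_fst, Measure.map_smul, Measure.map_smul]
    simp [a3, b3]
  · rw [lintegral_add_measure, lintegral_smul_measure, lintegral_smul_measure,
      ENNReal.ofReal_add (by positivity) (by positivity), ENNReal.ofReal_mul hs,
      ENNReal.ofReal_mul ht]
    simp only [smul_eq_mul]
    gcongr

section couplingValue

variable {L : ℝ} {g : (Fin m → ℝ) → ℝ}

theorem SeminormLipschitz.integral_comp_fst_le (hΓ : Γ.Nonempty) (hL : 0 ≤ L)
    (hg : SeminormLipschitz nrm L g) (hc : 0 ≤ c)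
    (hπ : π ∈ couplings nrm Ξ (uniformOn Γ wh) c) :
    ∫ p, g p.1 ∂π ≤ L * c + ∑ l ∈ Γ, g (wh l) / Γ.card :=
  BNWDRO.integral_comp_fst_le (α := fun l => g (wh l)) hΓ hc hπ hg hL fun l _ u _ => by
    linarith [hg u (wh l)]

theorem integral_le_couplingValue (hΓ : Γ.Nonempty) (hL : 0 ≤ L)
    (hg : SeminormLipschitz nrm L g) (hc : 0 ≤ c)
    (hπ : π ∈ couplings nrm Ξ (uniformOn Γ wh) c) :
    ∫ p, g p.1 ∂π ≤ couplingValue nrm Ξ (uniformOn Γ wh) g c := by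
  refine le_csSup ⟨L * c + ∑ l ∈ Γ, g (wh l) / Γ.card, ?_⟩ ⟨π, hπ, rfl⟩
  rintro _ ⟨π', hπ', rfl⟩
  exact hg.integral_comp_fst_le hΓ hL hc hπ'

theorem sum_le_couplingValue (hΓ : Γ.Nonempty) (hL : 0 ≤ L)
    (hg : SeminormLipschitz nrm L g) (hΞ : MeasurableSet Ξ) (hc : 0 ≤ c) {w : ι → Fin m → ℝ}
    (hw : ∀ l, w l ∈ Ξ) (hwc : ∑ l ∈ Γ, nrm (w l - wh l) / Γ.card ≤ c) :
    ∑ l ∈ Γ, g (w l) / Γ.card ≤ couplingValue nrm Ξ (uniformOn Γ wh) g c := by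
  have := integral_le_couplingValue hΓ hL hg hc (uniformOn_mem_couplings hΓ hΞ hw hwc)
  rwa [integral_uniformOn] at this

end couplingValue

end couplings

/-! ### Concavity of the value function and strong duality. -/

section duality

variable {m : ℕ} {ι : Type*} {nrm : Seminorm ℝ (Fin m → ℝ)} {Ξ : Set (Fin m → ℝ)}
  {Γ : Finset ι} {wh : ι → Fin m → ℝ} {L : ℝ} {g : (Fin m → ℝ) → ℝ}

theorem couplings_nonempty (hΓ : Γ.Nonempty) (hΞ : MeasurableSet Ξ) (hwh : ∀ l, wh l ∈ Ξ) {c : ℝ}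
    (hc : 0 ≤ c) : (couplings nrm Ξ (uniformOn Γ wh) c).Nonempty :=
  ⟨_, uniformOn_mem_couplings hΓ hΞ hwh (by simpa using hc)⟩

theorem exists_lt_integral (hΓ : Γ.Nonempty) (hΞ : MeasurableSet Ξ) (hwh : ∀ l, wh l ∈ Ξ) {c : ℝ}
    (hc : 0 ≤ c) {v : ℝ} (hv : v < couplingValue nrm Ξ (uniformOn Γ wh) g c) :
    ∃ π ∈ couplings nrm Ξ (uniformOn Γ wh) c, v < ∫ p, g p.1 ∂π := by
  obtain ⟨_, ⟨π, hπ, rfl⟩, h⟩ :=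
    exists_lt_of_lt_csSup ((couplings_nonempty hΓ hΞ hwh hc).image _) hv
  exact ⟨π, hπ, h⟩

theorem couplingValue_mono (hΓ : Γ.Nonempty) (hΞ : MeasurableSet Ξ) (hwh : ∀ l, wh l ∈ Ξ)
    (hL : 0 ≤ L) (hg : SeminormLipschitz nrm L g) {c c' : ℝ} (hc : 0 ≤ c) (hcc : c ≤ c') :
    couplingValue nrm Ξ (uniformOn Γ wh) g c ≤ couplingValue nrm Ξ (uniformOn Γ wh) g c' := by
  refine csSup_le ((couplings_nonempty hΓ hΞ hwh hc).image _) ?_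
  rintro _ ⟨π, hπ, rfl⟩
  exact integral_le_couplingValue hΓ hL hg (hc.trans hcc) (couplings_mono hcc hπ)

/-- Mixing couplings keeps the second marginal and averages costs and expectations; `ε`-optimal
couplings suffice. -/
theorem concaveOn_couplingValue (hΓ : Γ.Nonempty) (hΞ : MeasurableSet Ξ) (hwh : ∀ l, wh l ∈ Ξ)
    (hL : 0 ≤ L) (hg : SeminormLipschitz nrm L g) :
    ConcaveOn ℝ (Set.Ici 0) (couplingValue nrm Ξ (uniformOn Γ wh) g) := by
  refine ⟨convex_Ici 0, fun c hc c' hc' s t hs ht hst => le_of_forall_pos_sub_le fun ε hε => ?_⟩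
  obtain ⟨π, hπ, h1⟩ := exists_lt_integral (g := g) hΓ hΞ hwh hc (sub_lt_self _ hε)
  obtain ⟨π', hπ', h2⟩ := exists_lt_integral (g := g) hΓ hΞ hwh hc' (sub_lt_self _ hε)
  have := isProbabilityMeasure_uniformOn hΓ wh
  have hgP := integrable_uniformOn hΓ wh g
  have h3 := integral_le_couplingValue hΓ hL hg
    (add_nonneg (mul_nonneg hs hc) (mul_nonneg ht hc'))
    (convexCombo_mem_couplings hc hc' hπ hπ' hs ht hst)
  rw [integral_add_measure
    ((integrable_comp_fst hg hgP hπ).smul_measure ENNReal.ofReal_ne_top)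
    ((integrable_comp_fst hg hgP hπ').smul_measure ENNReal.ofReal_ne_top),
    integral_smul_measure, integral_smul_measure, ENNReal.toReal_ofReal hs,
    ENNReal.toReal_ofReal ht] at h3
  simp only [smul_eq_mul] at h3 ⊢
  refine le_trans ?_ h3
  have h4 := mul_le_mul_of_nonneg_left h1.le hs
  have h5 := mul_le_mul_of_nonneg_left h2.le ht
  calc _ = s * (couplingValue nrm Ξ (uniformOn Γ wh) g c - ε)
        + t * (couplingValue nrm Ξ (uniformOn Γ wh) g c' - ε) := by
        linear_combination ε * hst
    _ ≤ _ := add_le_add h4 h5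

/-- A concave function has a supergradient at an interior point. -/
theorem exists_supergradient {S : Set ℝ} {V : ℝ → ℝ} (hV : ConcaveOn ℝ S V) {θ : ℝ}
    (hθ : θ ∈ interior S) : ∃ r, ∀ c ∈ S, V c ≤ V θ + r * (c - θ) := by
  have hV' : ConvexOn ℝ S (-V) := hV.neg
  -- For the convex function `-V`, slopes to the left of `θ` are at most the right derivative, which
  -- is at most slopes to the right.
  refine ⟨-derivWithin (-V) (Set.Ioi θ) θ, fun c hc => ?_⟩
  rcases lt_trichotomy c θ with h | rfl | h
  · have := (hV'.slope_le_leftDeriv_of_mem_interior hc hθ h).trans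
      (hV'.leftDeriv_le_rightDeriv_of_mem_interior hθ)
    rw [slope_def_field, div_le_iff₀ (by linarith)] at this
    simp only [Pi.neg_apply] at this
    linarith
  · simp
  · have := hV'.rightDeriv_le_slope_of_mem_interior hθ hc h
    rw [slope_def_field, le_div_iff₀ (by linarith)] at this
    simp only [Pi.neg_apply] at this
    linarith

/-- At the endpoint `θ = 0` concavity alone would allow infinite slope; the Lipschitz constant `L`
serves there. For `θ > 0` monotonicity makes the slope nonnegative. -/
theorem exists_supergradient_couplingValue (hΓ : Γ.Nonempty) (hΞ : MeasurableSet Ξ)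
    (hwh : ∀ l, wh l ∈ Ξ) (hL : 0 ≤ L) (hg : SeminormLipschitz nrm L g) {θ : ℝ} (hθ : 0 ≤ θ) :
    ∃ r, 0 ≤ r ∧ ∀ c, 0 ≤ c → couplingValue nrm Ξ (uniformOn Γ wh) g c
      ≤ couplingValue nrm Ξ (uniformOn Γ wh) g θ + r * (c - θ) := by
  rcases hθ.eq_or_lt with rfl | hpos
  · refine ⟨L, hL, fun c hc => csSup_le ((couplings_nonempty hΓ hΞ hwh hc).image _) ?_⟩
    rintro _ ⟨π, hπ, rfl⟩
    have h1 := hg.integral_comp_fst_le hΓ hL hc hπ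
    have h2 := sum_le_couplingValue hΓ hL hg hΞ le_rfl hwh (wh := wh) (by simp)
    linarith
  · obtain ⟨r, hr⟩ := exists_supergradient (concaveOn_couplingValue hΓ hΞ hwh hL hg)
      (θ := θ) (by simpa using hpos)
    refine ⟨r, ?_, hr⟩
    have h1 := hr (θ + 1) (add_nonneg hθ zero_le_one)
    have h2 := couplingValue_mono hΓ hΞ hwh hL hg hθ (c' := θ + 1) (by linarith)
    linarith

/-- Strong duality for Wasserstein balls around a finitely supported distribution. -/
theorem exists_dual_solution [Finite ι] (hΓ : Γ.Nonempty) (hΞ : MeasurableSet Ξ)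
    (hwh : ∀ l, wh l ∈ Ξ) (hL : 0 ≤ L) (hg : SeminormLipschitz nrm L g) {θ : ℝ} (hθ : 0 ≤ θ) :
    ∃ (r : ℝ) (α : ι → ℝ), 0 ≤ r ∧ (∀ l ∈ Γ, ∀ u ∈ Ξ, g u ≤ r * nrm (u - wh l) + α l) ∧
      ∀ v < r * θ + ∑ l ∈ Γ, α l / Γ.card,
        ∃ Q ∈ wassersteinBall nrm Ξ θ (uniformOn Γ wh), v < ∫ u, g u ∂Q := by
  classical
  have hcard : 0 < (Γ.card : ℝ) := by exact_mod_cast hΓ.card_pos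
  obtain ⟨r, hr, hV⟩ := exists_supergradient_couplingValue hΓ hΞ hwh hL hg hθ
  set V := couplingValue nrm Ξ (uniformOn Γ wh) g
  have key : ∀ w : ι → Fin m → ℝ, (∀ l, w l ∈ Ξ) →
      r * θ + ∑ l ∈ Γ, (g (w l) - r * nrm (w l - wh l)) / Γ.card ≤ V θ := by
    intro w hw
    have hc : 0 ≤ ∑ l ∈ Γ, nrm (w l - wh l) / Γ.card :=
      Finset.sum_nonneg fun l _ => div_nonneg (apply_nonneg _ _) hcard.le
    have h1 := sum_le_couplingValue hΓ hL hg hΞ hc hw le_rfl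
    have h2 := hV _ hc
    have h3 : ∑ l ∈ Γ, (g (w l) - r * nrm (w l - wh l)) / Γ.card
        = ∑ l ∈ Γ, g (w l) / Γ.card - r * ∑ l ∈ Γ, nrm (w l - wh l) / Γ.card := by
      rw [Finset.mul_sum, ← Finset.sum_sub_distrib]
      exact Finset.sum_congr rfl fun l _ => by ring
    linarith
  let h : ι → (Fin m → ℝ) → ℝ := fun l u => g u - r * nrm (u - wh l)
  have hbdd : ∀ l ∈ Γ, BddAbove (h l '' Ξ) := by
    intro l hl
    refine ⟨Γ.card * (V θ - r * θ - ∑ j ∈ Γ.erase l, g (wh j) / Γ.card), ?_⟩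
    rintro _ ⟨u, hu, rfl⟩
    -- Move only the atom `l`; the others stay put at no cost.
    have h1 := key (Function.update wh l u) fun j => by
      rcases eq_or_ne j l with rfl | hj
      · simpa using hu
      · simpa [hj] using hwh j
    rw [← Finset.add_sum_erase _ _ hl, Function.update_self] at h1
    have h2 : ∑ j ∈ Γ.erase l, (g (Function.update wh l u j)
        - r * nrm (Function.update wh l u j - wh j)) / Γ.card
        = ∑ j ∈ Γ.erase l, g (wh j) / Γ.card := by
      refine Finset.sum_congr rfl fun j hj => ?_
      rw [Function.update_of_ne (Finset.ne_of_mem_erase hj)]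
      simp
    rw [h2] at h1
    have h3 : h l u / Γ.card ≤ V θ - r * θ - ∑ j ∈ Γ.erase l, g (wh j) / Γ.card := by
      simp only [h]
      linarith
    rwa [div_le_iff₀' hcard] at h3
  refine ⟨r, fun l => sSup (h l '' Ξ), hr, fun l hl u hu => ?_, fun v hv => ?_⟩
  · have := le_csSup (hbdd l hl) ⟨u, hu, rfl⟩
    simp only [h] at this ⊢
    linarith
  · have hle : r * θ + ∑ l ∈ Γ, sSup (h l '' Ξ) / Γ.card ≤ V θ := by
      refine le_of_forall_pos_sub_le fun ε hε => ?_
      -- Near-maximizers chosen independently for each atom are jointly admissible in `key`, which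
      -- has no budget constraint.
      have hw : ∀ l, ∃ u ∈ Ξ, sSup (h l '' Ξ) - ε < h l u := by
        intro l
        obtain ⟨_, ⟨u, hu, rfl⟩, hlt⟩ := exists_lt_of_lt_csSup
          (Set.Nonempty.image (h l) ⟨wh l, hwh l⟩) (sub_lt_self (sSup (h l '' Ξ)) hε)
        exact ⟨u, hu, hlt⟩
      choose w hwΞ hw using hw
      have h1 := key w hwΞ
      have h2 : ∑ l ∈ Γ, sSup (h l '' Ξ) / Γ.card - ε ≤ ∑ l ∈ Γ, h l (w l) / Γ.card := by
        calc _ = ∑ l ∈ Γ, (sSup (h l '' Ξ) - ε) / Γ.card := by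
              simp only [sub_div, Finset.sum_sub_distrib, Finset.sum_const, nsmul_eq_mul]
              rw [mul_div_cancel₀ _ hcard.ne']
          _ ≤ _ := Finset.sum_le_sum fun l _ =>
              div_le_div_of_nonneg_right (hw l).le hcard.le
      simp only [h] at h2 ⊢
      linarith
    obtain ⟨π, hπ, hlt⟩ := exists_lt_integral hΓ hΞ hwh hθ (hv.trans_le hle)
    exact ⟨π.fst, fst_mem_wassersteinBall hπ, by rwa [integral_fst hg.continuous]⟩

end duality

/-! ### Duality for the finite program. -/

section program

variable {n m q N K I : ℕ} {nrm : Seminorm ℝ (Fin m → ℝ)} {X : Set (Fin n → ℝ)}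
  {a : Fin I → (Fin n → ℝ) → (Fin m → ℝ)} {b : Fin I → ℝ}
  {C : Matrix (Fin q) (Fin m) ℝ} {d : Fin q → ℝ}
  {wh : Fin N → Fin m → ℝ} {z : Fin N → Fin K} {θ : Fin K → ℝ}

theorem measurableSet_polyhedron (C : Matrix (Fin q) (Fin m) ℝ) (d : Fin q → ℝ) :
    MeasurableSet (polyhedron C d) :=
  (isClosed_le (Continuous.matrix_mulVec continuous_const continuous_id)
    continuous_const).measurableSet

theorem cluster_nonempty (hz : Function.Surjective z) (k : Fin K) : (cluster z k).Nonempty := by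
  obtain ⟨l, hl⟩ := hz k
  exact ⟨l, by simp [cluster, hl]⟩

theorem card_div_ne_top (hN : 0 < N) (k : Fin K) :
    ((cluster z k).card : ENNReal) / (N : ENNReal) ≠ ⊤ :=
  ENNReal.div_ne_top (by simp) (by simpa using hN.ne')

/-- Write `e = Cᵀ ψ - (Cᵀ ψ - e)`: on the polyhedron the first term is controlled by `ψ ⬝ᵥ d`, the
second by the dual norm. -/
theorem affine_le_of_multiplier (hnrm : IsNorm nrm) {e w₀ : Fin m → ℝ} {ψ : Fin q → ℝ} {β r α : ℝ}
    (hψ : 0 ≤ ψ) (hα : e ⬝ᵥ w₀ + ψ ⬝ᵥ (d - C *ᵥ w₀) + β ≤ α)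
    (hr : dualNorm nrm (Cᵀ *ᵥ ψ - e) ≤ r) {u : Fin m → ℝ} (hu : u ∈ polyhedron C d) :
    e ⬝ᵥ u + β ≤ r * nrm (u - w₀) + α := by
  have h1 := hnrm.dotProduct_le hr (w₀ - u)
  rw [map_sub_rev, sub_dotProduct, mulVec_transpose, ← dotProduct_mulVec, mulVec_sub] at h1
  have h2 : ψ ⬝ᵥ (C *ᵥ u) ≤ ψ ⬝ᵥ d := dotProduct_le_dotProduct_of_nonneg_left hu hψ
  simp only [dotProduct_sub] at h1 hα
  linarith

theorem integrable_of_mem_ambiguitySet [NeZero I] (hN : 0 < N) (hnrm : IsNorm nrm)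
    (hz : Function.Surjective z) (hθ : ∀ k, 0 ≤ θ k) {Ξ : Set (Fin m → ℝ)}
    {Q : Measure (Fin m → ℝ)} (hQ : Q ∈ ambiguitySet nrm Ξ wh z θ) (x : Fin n → ℝ) :
    Integrable (maxAffineLoss a b x) Q := by
  obtain ⟨L, hL, hg⟩ := hnrm.exists_seminormLipschitz_maxAffineLoss a b x
  obtain ⟨Qk, hQk, rfl⟩ := hQ
  rw [integrable_finsetSum_measure]
  exact fun k _ => (integrable_of_mem_wassersteinBall hg
    (integrable_uniformOn (cluster_nonempty hz k) wh _) (hθ k) (hQk k)).smul_measure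
      (card_div_ne_top hN k)

theorem integral_mixture {Qk : Fin K → Measure (Fin m → ℝ)} {g : (Fin m → ℝ) → ℝ} (hN : 0 < N)
    (h : ∀ k, Integrable g (Qk k)) :
    ∫ u, g u ∂(∑ k, (((cluster z k).card : ENNReal) / (N : ENNReal)) • Qk k)
      = ∑ k, ((cluster z k).card : ℝ) / N * ∫ u, g u ∂(Qk k) := by
  rw [integral_finsetSum_measure fun k _ => (h k).smul_measure (card_div_ne_top hN k)]
  simp [integral_smul_measure, ENNReal.toReal_div]

/-- Weak duality for the finite program. -/
theorem worstCase_le_programCost [NeZero I] (hN : 0 < N) (hnrm : IsNorm nrm)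
    (hz : Function.Surjective z) (hθ : ∀ k, 0 ≤ θ k) {p : ProgramVar n N K I q}
    (hp : p ∈ programFeasible nrm X C d a b wh z) :
    worstCase (ambiguitySet nrm (polyhedron C d) wh z θ) (maxAffineLoss a b p.x)
      ≤ (programCost z θ p : EReal) := by
  obtain ⟨-, h1, h2, h3, h4⟩ := hp
  obtain ⟨L, hL, hg⟩ := hnrm.exists_seminormLipschitz_maxAffineLoss a b p.x
  refine iSup₂_le fun Q hQ => EReal.coe_le_coe_iff.2 ?_
  obtain ⟨Qk, hQk, rfl⟩ := hQ
  rw [integral_mixture hN fun k => integrable_of_mem_wassersteinBall hg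
    (integrable_uniformOn (cluster_nonempty hz k) wh _) (hθ k) (hQk k)]
  refine Finset.sum_le_sum fun k _ => mul_le_mul_of_nonneg_left ?_ (by positivity)
  exact integral_le_of_mem_wassersteinBall (cluster_nonempty hz k) (hθ k) (hQk k) hg (h1 k)
    fun l hl u hu => ciSup_le fun i =>
      affine_le_of_multiplier hnrm (h2 l i) (h3 l i) (h4 k l hl i) hu

/-- Strong duality for the finite program, with dual attainment. -/
theorem exists_programCost_le_worstCase [NeZero I] (hN : 0 < N) (hnrm : IsNorm nrm)
    (hwh : ∀ l, wh l ∈ polyhedron C d) (hz : Function.Surjective z) (hθ : ∀ k, 0 ≤ θ k)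
    {x : Fin n → ℝ} (hx : x ∈ X) :
    ∃ p ∈ programFeasible (q := q) nrm X C d a b wh z, p.x = x ∧ (programCost z θ p : EReal)
      ≤ worstCase (ambiguitySet nrm (polyhedron C d) wh z θ) (maxAffineLoss a b x) := by
  obtain ⟨L, hL, hg⟩ := hnrm.exists_seminormLipschitz_maxAffineLoss a b x
  choose r α hr hα hQ using fun k => exists_dual_solution (cluster_nonempty hz k)
    (measurableSet_polyhedron C d) hwh hL hg (hθ k)
  -- Each index `l` uses the dual solution of its own cluster `z l`; each affine piece lies below
  -- the maximum `g`.
  have hψ : ∀ l i, ∃ ψ : Fin q → ℝ, 0 ≤ ψ ∧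
      a i x ⬝ᵥ wh l + ψ ⬝ᵥ (d - C *ᵥ wh l) + b i ≤ α (z l) l ∧
      dualNorm nrm (Cᵀ *ᵥ ψ - a i x) ≤ r (z l) := fun l i =>
    exists_multiplier_of_affine_le nrm C d (hwh l) _ _ (hr _) fun w hw =>
      (le_ciSup (f := fun i => a i x ⬝ᵥ w + b i) (Set.finite_range _).bddAbove i).trans
        (hα (z l) l (by simp [cluster]) w hw)
  choose ψ hψ0 hψα hψr using hψ
  refine ⟨⟨x, r, fun l => α (z l) l, ψ⟩, ⟨hx, hr, hψ0, hψα, fun k l hl i => ?_⟩, rfl, ?_⟩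
  · obtain rfl : z l = k := by simpa [cluster] using hl
    exact hψr l i
  have hcost : programCost z θ ⟨x, r, fun l => α (z l) l, ψ⟩
      = ∑ k, ((cluster z k).card : ℝ) / N *
        (r k * θ k + ∑ l ∈ cluster z k, α k l / ((cluster z k).card : ℝ)) := by
    refine Finset.sum_congr rfl fun k _ => ?_
    congr 2
    refine Finset.sum_congr rfl fun l hl => ?_
    obtain rfl : z l = k := by simpa [cluster] using hl
    rfl
  rw [hcost]
  set W : ℝ := ∑ k, ((cluster z k).card : ℝ) / N
  set c : Fin K → ℝ := fun k => r k * θ k + ∑ l ∈ cluster z k, α k l / ((cluster z k).card : ℝ)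
  refine EReal.ge_of_forall_gt_iff_ge.1 fun v hv => ?_
  have hv' := EReal.coe_lt_coe_iff.1 hv
  have hW : 0 ≤ W := Finset.sum_nonneg fun k _ => by positivity
  -- Being `ε`-suboptimal in every cluster costs `W * ε` in total, which is below the gap `ε * (W +
  -- 1)`. The `+ 1` keeps the denominator positive without computing `W`.
  set ε : ℝ := (∑ k, ((cluster z k).card : ℝ) / N * c k - v) / (W + 1)
  have hε : 0 < ε := div_pos (sub_pos.2 hv') (by linarith)
  choose Qk hQk hlt using fun k => hQ k (c k - ε) (sub_lt_self _ hε)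
  refine le_trans (EReal.coe_le_coe_iff.2 ?_) (le_iSup₂_of_le _ ⟨Qk, hQk, rfl⟩ le_rfl)
  rw [integral_mixture hN fun k => integrable_of_mem_wassersteinBall hg
    (integrable_uniformOn (cluster_nonempty hz k) wh _) (hθ k) (hQk k)]
  have hεW : ε * (W + 1) = ∑ k, ((cluster z k).card : ℝ) / N * c k - v :=
    div_mul_cancel₀ _ (by linarith)
  calc v ≤ ∑ k, ((cluster z k).card : ℝ) / N * c k - W * ε := by linarith
    _ = ∑ k, ((cluster z k).card : ℝ) / N * (c k - ε) := by
      simp only [W, mul_sub, Finset.sum_sub_distrib, Finset.sum_mul]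
    _ ≤ _ := Finset.sum_le_sum fun k _ => mul_le_mul_of_nonneg_left (hlt k).le (by positivity)

end program

end BNWDRO

/-! ### Equivalence of the two problems. -/

theorem corollary1 {n m q N K I : ℕ} (hN : 0 < N) (hI : 0 < I)
    (nrm : Seminorm ℝ (Fin m → ℝ)) (hnrm : BNWDRO.IsNorm nrm)
    (X : Set (Fin n → ℝ)) (f : (Fin n → ℝ) → EReal)
    (a : Fin I → (Fin n → ℝ) → (Fin m → ℝ)) (b : Fin I → ℝ)
    (C : Matrix (Fin q) (Fin m) ℝ) (d : Fin q → ℝ)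
    (wh : Fin N → Fin m → ℝ) (hwh : ∀ l, wh l ∈ BNWDRO.polyhedron C d)
    (z : Fin N → Fin K) (hz : Function.Surjective z)
    (θ : Fin K → ℝ) (hθ : ∀ k, 0 ≤ θ k)
    -- the ambiguity set
    (B : Set (Measure (Fin m → ℝ)))
    (hB : B = BNWDRO.ambiguitySet nrm (BNWDRO.polyhedron C d) wh z θ)
    -- the piecewise affine loss
    (g : (Fin n → ℝ) → (Fin m → ℝ) → ℝ) (hg : g = BNWDRO.maxAffineLoss a b)
    -- the feasible set of the finite program
    (F : Set (BNWDRO.ProgramVar n N K I q))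
    (hF : F = BNWDRO.programFeasible nrm X C d a b wh z) :
    -- the expectations under the measures of the ambiguity set exist
    (∀ x ∈ X, ∀ Q ∈ B, Integrable (g x) Q) ∧
    -- for each decision, the worst-case expectation is the minimum of the finite program
    -- over the other variables
    (∀ x ∈ X, IsLeast
      ((fun p => (BNWDRO.programCost z θ p : EReal)) '' {p | p ∈ F ∧ p.x = x})
      (BNWDRO.worstCase B (g x))) ∧
    -- the optimal values agree
    (⨅ x ∈ X, BNWDRO.robustObjective f g B x) = (⨅ p ∈ F, BNWDRO.programObjective f z θ p) ∧
    -- the optimal decisions agree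
    (∀ x, (x ∈ X ∧ IsMinOn (BNWDRO.robustObjective f g B) X x) ↔
      ∃ p ∈ F, p.x = x ∧ IsMinOn (BNWDRO.programObjective f z θ) F p) := by
  have : NeZero I := ⟨hI.ne'⟩
  have hmem : ∀ p ∈ F, p.x ∈ X := by
    rintro p hp
    rw [hF] at hp
    exact hp.1
  have hle : ∀ p ∈ F, BNWDRO.robustObjective f g B p.x ≤ BNWDRO.programObjective f z θ p := by
    intro p hp
    subst hB hg hF
    exact add_le_add le_rfl (BNWDRO.worstCase_le_programCost hN hnrm hz hθ hp)
  have hex : ∀ x ∈ X, ∃ p ∈ F, p.x = x ∧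
      (BNWDRO.programCost z θ p : EReal) = BNWDRO.worstCase B (g x) := by
    intro x hx
    subst hB hg hF
    obtain ⟨p, hp, rfl, h⟩ := BNWDRO.exists_programCost_le_worstCase (a := a) (b := b)
      hN hnrm hwh hz hθ hx
    exact ⟨p, hp, rfl, h.antisymm (BNWDRO.worstCase_le_programCost hN hnrm hz hθ hp)⟩
  -- Attainment makes the objectives equal for a suitable `p` over each `x`. With `hle`, this
  -- transfers both optimal values and minimizers, even where `f` is infinite.
  have hex' : ∀ x ∈ X, ∃ p ∈ F, p.x = x ∧
      BNWDRO.programObjective f z θ p = BNWDRO.robustObjective f g B x := by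
    intro x hx
    obtain ⟨p, hp, rfl, h⟩ := hex x hx
    exact ⟨p, hp, rfl, by rw [BNWDRO.programObjective, h, BNWDRO.robustObjective]⟩
  refine ⟨fun x _ Q hQ => ?_, fun x hx => ⟨?_, ?_⟩, le_antisymm ?_ ?_, fun x => ⟨?_, ?_⟩⟩
  · subst hB hg
    exact BNWDRO.integrable_of_mem_ambiguitySet hN hnrm hz hθ hQ x
  · obtain ⟨p, hp, hpx, h⟩ := hex x hx
    exact ⟨p, ⟨hp, hpx⟩, h⟩
  · rintro _ ⟨p, ⟨hp, rfl⟩, rfl⟩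
    subst hB hg hF
    exact BNWDRO.worstCase_le_programCost hN hnrm hz hθ hp
  · exact le_iInf₂ fun p hp => (iInf₂_le p.x (hmem p hp)).trans (hle p hp)
  · refine le_iInf₂ fun x hx => ?_
    obtain ⟨p, hp, -, h⟩ := hex' x hx
    exact (iInf₂_le p hp).trans h.le
  · rintro ⟨hx, hmin⟩
    obtain ⟨p, hp, hpx, h⟩ := hex' x hx
    refine ⟨p, hp, hpx, fun p' hp' => ?_⟩
    exact h.le.trans ((hmin (hmem p' hp')).trans (hle p' hp'))
  · rintro ⟨p, hp, rfl, hmin⟩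
    refine ⟨hmem p hp, fun x' hx' => ?_⟩
    obtain ⟨p', hp', -, h⟩ := hex' x' hx'
    exact (hle p hp).trans ((hmin hp').trans h.le)
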